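/- Let $K$ be a positive integer and let $\lambda_1,\dots,\lambda_K$ and $\nu_1,\dots,\nu_K$ be positive real numbers. Let $\phi_1,\dots,\phi_K\in H^{1/2}(\mathbb{R}^3)$ be complex-valued functions solving, in the sense of tempered distributions, the system \[ \big(\sqrt{1-\Delta}-1+\nu_j\big)\phi_j=\mathcal{N}_j(\phi_1,\dots,\phi_K),\qquad j=1,\dots,K, \] where $\sqrt{1-\Delta}$ is the Fourier multiplier operator which is the positive square root of $1-\Delta$, and \[ \mathcal{N}_j(\phi_1,\dots,\phi_K)=\sum_{k=1}^K\lambda_k\Big(\frac{1}{|x|}*|\phi_k|^2\Big)\phi_j-\sum_{k=1}^K\lambda_k\Big(\frac{1}{|x|}*(\phi_j\overline{\phi_k})\Big)\phi_k . \] Then, for each $j=1,\dots,K$, $\phi_j$ belongs to $H^s(\mathbb{R}^3)$ for every $s\ge 1/2$. -/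

import Mathlib

open MeasureTheory TemperedDistribution
open scoped SchwartzMap Convolution Laplacian

noncomputable section

namespace RelHartreeFock

/-- Physical space `ℝ³`. -/
abbrev Space : Type := EuclideanSpace ℝ (Fin 3)

/-- The Fourier symbol of `√(1 - Δ)`. With the Fourier transform
`𝓕 f ξ = ∫ exp (-2πi ⟪x, ξ⟫) f x` the operator `-Δ` has the symbol `(2π‖ξ‖)²`. -/
def relSymbol (ξ : Space) : ℂ := ((Real.sqrt (1 + (2 * Real.pi * ‖ξ‖) ^ 2) : ℝ) : ℂ)

theorem relSymbol_hasTemperateGrowth : relSymbol.HasTemperateGrowth := by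
  have h1 := Function.hasTemperateGrowth_one_add_norm_sq_rpow Space (1 / 2)
  have h2 : (fun ξ : Space => (2 * Real.pi) • ξ).HasTemperateGrowth :=
    ((2 * Real.pi) • ContinuousLinearMap.id ℝ Space).hasTemperateGrowth
  have h3 := Function.HasTemperateGrowth.comp Function.Complex.hasTemperateGrowth_ofReal (h1.comp h2)
  have h : relSymbol = fun ξ : Space =>
      ((((1 + ‖(2 * Real.pi) • ξ‖ ^ 2) ^ (1 / 2 : ℝ) : ℝ)) : ℂ) := by
    funext ξ
    rw [relSymbol, Real.sqrt_eq_rpow, norm_smul, Real.norm_of_nonneg (by positivity)]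
  rw [h]
  exact h3

/-- The operator `√(1 - Δ)` on tempered distributions on `ℝ³`, as a Fourier multiplier. -/
def sqrtOneSubLaplacian : 𝓢'(Space, ℂ) →L[ℂ] 𝓢'(Space, ℂ) :=
  fourierMultiplierCLM ℂ relSymbol

/-- The square of `√(1 - Δ)` is `1 - Δ`, with the distributional Laplacian. -/
theorem sqrtOneSubLaplacian_sqrtOneSubLaplacian (f : 𝓢'(Space, ℂ)) :
    sqrtOneSubLaplacian (sqrtOneSubLaplacian f) = f - Δ f := by
  have hsq : (fun x : Space => Complex.ofReal (‖x‖ ^ 2)).HasTemperateGrowth := by fun_prop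
  have hsum : relSymbol * relSymbol =
      (fun _ : Space => (1 : ℂ)) + (((2 * Real.pi) ^ 2 : ℝ) : ℂ) •
        fun x : Space => Complex.ofReal (‖x‖ ^ 2) := by
    funext ξ
    have hs := Real.mul_self_sqrt (show 0 ≤ 1 + (2 * Real.pi * ‖ξ‖) ^ 2 by positivity)
    simp only [Pi.mul_apply, Pi.add_apply, Pi.smul_apply, relSymbol, smul_eq_mul]
    rw [← Complex.ofReal_mul, hs]
    push_cast
    ring
  have hconst : (fun _ : Space => (1 : ℂ)).HasTemperateGrowth := .const _
  have hmul : ((((2 * Real.pi) ^ 2 : ℝ) : ℂ) •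
      fun x : Space => Complex.ofReal (‖x‖ ^ 2)).HasTemperateGrowth :=
    (Function.HasTemperateGrowth.const (((2 * Real.pi) ^ 2 : ℝ) : ℂ)).mul hsq
  rw [sqrtOneSubLaplacian, fourierMultiplierCLM_fourierMultiplierCLM_apply
    relSymbol_hasTemperateGrowth relSymbol_hasTemperateGrowth, hsum,
    laplacian_eq_fourierMultiplierCLM, fourierMultiplierCLM_apply, smulLeftCLM_add hconst hmul]
  rw [smulLeftCLM_smul hsq]
  simp [fourierMultiplierCLM_apply, FourierTransform.fourierInv_add,
    FourierTransform.fourierInv_smul]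
  rw [← Complex.coe_smul]
  push_cast
  rfl

/-- The Newtonian convolution `(1 / |x|) * g` on `ℝ³`, that is
`x ↦ ∫ y, g (x - y) / ‖y‖`. -/
def newton (g : Space → ℂ) : Space → ℂ :=
  (fun y : Space => ((1 / ‖y‖ : ℝ) : ℂ)) ⋆[ContinuousLinearMap.mul ℝ ℂ, volume] g

/-- The Hartree-Fock nonlinearity: the direct term
`∑ₖ λₖ (1/|x| * |φₖ|²) φⱼ` minus the exchange term `∑ₖ λₖ (1/|x| * (φⱼ conj φₖ)) φₖ`. -/
def nonlinearity {K : ℕ} (lam : Fin K → ℝ) (φ : Fin K → Space → ℂ) (j : Fin K)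
    (x : Space) : ℂ :=
  (∑ k, (lam k : ℂ) * newton (fun y => ((‖φ k y‖ ^ 2 : ℝ) : ℂ)) x * φ j x) -
    ∑ k, (lam k : ℂ) * newton (fun y => φ j y * (starRingEnd ℂ) (φ k y)) x * φ k x

/-- The `φⱼ ∈ L²(ℝ³)` solve the system `(√(1 - Δ) - 1 + νⱼ) φⱼ = Nⱼ(φ₁, …, φ_K)` in the sense of
tempered distributions. -/
def IsSolution {K : ℕ} (lam ν : Fin K → ℝ) (φ : Fin K → Lp ℂ 2 (volume : Measure Space)) :
    Prop :=
  ∀ (j : Fin K) (u : 𝓢(Space, ℂ)),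
    (sqrtOneSubLaplacian (φ j : 𝓢'(Space, ℂ)) - (φ j : 𝓢'(Space, ℂ)) +
        (ν j : ℂ) • (φ j : 𝓢'(Space, ℂ))) u =
      ∫ x : Space, u x * nonlinearity lam (fun k => (φ k : Space → ℂ)) j x

end RelHartreeFock

end

namespace RelHartreeFock

open scoped ENNReal FourierTransform

/-! The proof is a bootstrap in steps of half a derivative. If all `φ j` lie in H^s with s ≥ 1/2,
the nonlinearity lies in H^(s-1/2) (`exists_memSobolev_newton_mul`). By the equation so does √(1-Δ)
φ_j, and inverting this operator of order one puts φ_j in H^(s+1/2).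

The trilinear term (1/|x| * (a conj b)) c is estimated on the Fourier side. There the potential has
density V(e) = 𝓕(a conj b)(e) / (π|e|²), and multiplication by c becomes convolution of V with 𝓕 c.
With t = s - 1/2, Peetre's inequality distributes the weight of order t over the factors, so Young's
L¹ * L² → L² reduces the estimate to the weighted integrability of V. Since 𝓕(a conj b) is dominated
by a correlation of 𝓕 a and 𝓕 b, what remains is finiteness of ∬ B(z) A(z+e) / |e|², where A and B
are L² against 1 + |z|. This is where half a derivative is spent; a Schur test proves it. -/

/-! ### Kato's inequality by a Schur test -/

theorem integrable_radial_one :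
    Integrable (fun x : Space => (‖x‖ ^ 2 * (1 + ‖x‖ ^ 2))⁻¹) := by
  rw [integrable_fun_norm_addHaar (μ := (volume : Measure Space))
    (f := fun y : ℝ => (y ^ 2 * (1 + y ^ 2))⁻¹)]
  refine (integrable_inv_one_add_sq.integrableOn (s := Set.Ioi 0)).congr_fun (fun y hy => ?_)
    measurableSet_Ioi
  have hy : (0 : ℝ) < y := hy
  simp only [finrank_euclideanSpace, Fintype.card_fin, smul_eq_mul]
  field_simp

/-- The integral of `1 / (‖x‖² (r² + ‖x‖²))` over `ℝ³` is a constant over `r`. -/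
theorem lintegral_radial {r : ℝ} (hr : 0 < r) :
    ∫⁻ x : Space, ENNReal.ofReal (‖x‖ ^ 2 * (r ^ 2 + ‖x‖ ^ 2))⁻¹ =
      ENNReal.ofReal ((∫ x : Space, (‖x‖ ^ 2 * (1 + ‖x‖ ^ 2))⁻¹) / r) := by
  -- Scaling x = r y gives r⁻⁴ from the integrand and r³ from the volume, hence 1/r.
  have h : (fun x : Space => (‖x‖ ^ 2 * (r ^ 2 + ‖x‖ ^ 2))⁻¹) = fun x =>
      (r ^ 4)⁻¹ * (fun y : Space => (‖y‖ ^ 2 * (1 + ‖y‖ ^ 2))⁻¹) (r⁻¹ • x) := by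
    funext x
    simp only [norm_smul, norm_inv, Real.norm_of_nonneg hr.le]
    rw [← mul_inv]
    congr 1
    field_simp
  have hint : Integrable (fun x : Space => (‖x‖ ^ 2 * (r ^ 2 + ‖x‖ ^ 2))⁻¹) := by
    rw [h]
    exact (integrable_radial_one.comp_smul (inv_ne_zero hr.ne')).const_mul _
  rw [← ofReal_integral_eq_lintegral_ofReal hint (ae_of_all _ fun x => by positivity)]
  congr 1
  rw [h, integral_const_mul, Measure.integral_comp_smul volume
    (fun y : Space => (‖y‖ ^ 2 * (1 + ‖y‖ ^ 2))⁻¹) r⁻¹]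
  simp only [finrank_euclideanSpace, Fintype.card_fin, smul_eq_mul, inv_pow, inv_inv]
  rw [abs_of_pos (by positivity)]
  field_simp

/-- The two bounding functions are radial about e = 0 and e = -z, so each integrates exactly. Since
1 + |z| ≤ (1 + |z+e|) + |e|, the larger of 1 + |z+e| and |e| is at least (1 + |z|)/2; the constant
is 5 = 2² + 1. The two exceptional values of e form a null set. -/
theorem inv_mul_inv_le_radial (z e : Space) :
    ((1 + ‖z + e‖) ^ 2 * ‖e‖ ^ 2)⁻¹ ≤ 5 * ((‖e‖ ^ 2 * ((1 + ‖z‖) ^ 2 + ‖e‖ ^ 2))⁻¹ +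
      (‖z + e‖ ^ 2 * ((1 + ‖z‖) ^ 2 + ‖z + e‖ ^ 2))⁻¹) ∨ e = 0 ∨ z + e = 0 := by
  rcases eq_or_ne e 0 with he | he
  · simp [he]
  rcases eq_or_ne (z + e) 0 with hz | hz
  · simp [hz]
  left
  have h1 : ‖z‖ ≤ ‖z + e‖ + ‖e‖ := by simpa using norm_sub_le (z + e) e
  have hq : 0 < ‖e‖ := norm_pos_iff.mpr he
  have hp : 0 < ‖z + e‖ := norm_pos_iff.mpr hz
  have hz0 := norm_nonneg z
  set q := ‖e‖
  set p := ‖z + e‖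
  set r := ‖z‖
  have key : ∀ a b c : ℝ, 0 < a → 0 < b → 0 < c → c ≤ 5 * a → (a * b)⁻¹ ≤ 5 * (b * c)⁻¹ := by
    intro a b c ha hb hc h
    rw [← div_eq_mul_inv, le_div_iff₀ (by positivity)]
    have : (a * b)⁻¹ * (b * c) = c / a := by field_simp
    rw [this, div_le_iff₀ ha]
    exact h
  rcases le_total q (1 + p) with h | h
  · have := key ((1 + p) ^ 2) (q ^ 2) ((1 + r) ^ 2 + q ^ 2) (by positivity) (by positivity)
      (by positivity) (by nlinarith)
    have h2 : 0 ≤ (p ^ 2 * ((1 + r) ^ 2 + p ^ 2))⁻¹ := by positivity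
    linarith
  · have h3 := key (q ^ 2) (p ^ 2) ((1 + r) ^ 2 + p ^ 2) (by positivity) (by positivity)
      (by positivity) (by nlinarith)
    have h2 : 0 ≤ (q ^ 2 * ((1 + r) ^ 2 + q ^ 2))⁻¹ := by positivity
    have h4 : ((1 + p) ^ 2 * q ^ 2)⁻¹ ≤ (q ^ 2 * p ^ 2)⁻¹ := by
      rw [mul_comm]
      gcongr
      linarith
    linarith

/-- The bound behind the Schur test for the kernel `1 / ‖x - y‖²`. -/
theorem exists_lintegral_inv_mul_inv_le : ∃ C : ℝ, 0 ≤ C ∧ ∀ z : Space,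
    ∫⁻ e : Space, ENNReal.ofReal ((1 + ‖z + e‖) ^ 2 * ‖e‖ ^ 2)⁻¹ ≤
      ENNReal.ofReal (C / (1 + ‖z‖)) := by
  set I : ℝ := ∫ x : Space, (‖x‖ ^ 2 * (1 + ‖x‖ ^ 2))⁻¹
  have hI : 0 ≤ I := integral_nonneg fun x => by positivity
  -- The factor 10 is the pointwise constant 5 times two translates with the same integral.
  refine ⟨10 * I, by positivity, fun z => ?_⟩
  set G : Space → ℝ≥0∞ := fun x => ENNReal.ofReal (‖x‖ ^ 2 * ((1 + ‖z‖) ^ 2 + ‖x‖ ^ 2))⁻¹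
  have hG : Measurable G := by fun_prop
  have hne : ∀ a : Space, ∀ᵐ e : Space, e ≠ a := fun a => by
    simp [ae_iff]
  have hGint : ∫⁻ x, G x = ENNReal.ofReal (I / (1 + ‖z‖)) := lintegral_radial (by positivity)
  calc _ ≤ ∫⁻ e, 5 * (G e + G (z + e)) := by
        refine lintegral_mono_ae ?_
        filter_upwards [hne 0, hne (-z)] with e h0 hz
        have h := (inv_mul_inv_le_radial z e).resolve_right
          (not_or.mpr ⟨h0, fun h => hz (eq_neg_of_add_eq_zero_right h)⟩)
        calc _ ≤ _ := ENNReal.ofReal_le_ofReal h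
          _ = _ := by
            rw [ENNReal.ofReal_mul (by norm_num), ENNReal.ofReal_add (by positivity) (by positivity)]
            simp [G]
    _ = 5 * ((∫⁻ e, G e) + ∫⁻ e, G e) := by
        rw [lintegral_const_mul _ (by fun_prop), lintegral_add_left hG,
          lintegral_add_left_eq_self G z]
    _ = ENNReal.ofReal (10 * I / (1 + ‖z‖)) := by
        rw [hGint, ← ENNReal.ofReal_add (by positivity) (by positivity)]
        rw [show (5 : ℝ≥0∞) = ENNReal.ofReal 5 by simp, ← ENNReal.ofReal_mul (by norm_num)]
        congr 1
        ring

/-- Kato's inequality on the Fourier side. -/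
theorem lintegral_lintegral_inv_sq_lt_top {A B : Space → ℝ≥0∞} (hA : Measurable A)
    (hB : Measurable B) (hA2 : ∫⁻ z, ENNReal.ofReal (1 + ‖z‖) * A z ^ 2 < ∞)
    (hB2 : ∫⁻ z, ENNReal.ofReal (1 + ‖z‖) * B z ^ 2 < ∞) :
    ∫⁻ e : Space, ∫⁻ z : Space, B z * A (z + e) * ENNReal.ofReal (‖e‖ ^ 2)⁻¹ < ∞ := by
  obtain ⟨C, hC, hk⟩ := exists_lintegral_inv_mul_inv_le
  -- Schur weights: integrating v(z+e)/|e|² in e gives at most C/(1+|z|), and multiplying by w(z) =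
  -- (1+|z|)² leaves C(1+|z|), the weight in the hypotheses.
  set w : Space → ℝ≥0∞ := fun z => ENNReal.ofReal ((1 + ‖z‖) ^ 2)
  set v : Space → ℝ≥0∞ := fun z => ENNReal.ofReal ((1 + ‖z‖) ^ 2)⁻¹
  set k : Space → ℝ≥0∞ := fun e => ENNReal.ofReal (‖e‖ ^ 2)⁻¹
  have hw : Measurable w := by fun_prop
  have hv : Measurable v := by fun_prop
  have hkm : Measurable k := by fun_prop
  have hwv : ∀ z, w z * v z = 1 := fun z => by
    rw [← ENNReal.ofReal_mul (by positivity), mul_inv_cancel₀ (by positivity), ENNReal.ofReal_one]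
  have hkv : ∀ z : Space, ∫⁻ e, v (z + e) * k e ≤ ENNReal.ofReal (C / (1 + ‖z‖)) := fun z => by
    refine le_trans (le_of_eq ?_) (hk z)
    refine lintegral_congr fun e => ?_
    rw [mul_inv, ENNReal.ofReal_mul (by positivity)]
  have hsum : ∀ D : Space → ℝ≥0∞, Measurable D →
      ∫⁻ z, ENNReal.ofReal (1 + ‖z‖) * D z ^ 2 < ∞ →
      ∫⁻ z, ∫⁻ e, D z ^ 2 * w z * v (z + e) * k e < ∞ := by
    intro D hD hD2
    calc _ ≤ ∫⁻ z, ENNReal.ofReal C * (ENNReal.ofReal (1 + ‖z‖) * D z ^ 2) := by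
          refine lintegral_mono fun z => ?_
          simp only [mul_assoc]
          rw [lintegral_const_mul _ (by fun_prop), lintegral_const_mul _ (by fun_prop)]
          calc _ ≤ D z ^ 2 * (w z * ENNReal.ofReal (C / (1 + ‖z‖))) := by
                gcongr
                exact hkv z
            _ = _ := by
                rw [← ENNReal.ofReal_mul (by positivity), mul_comm, ← mul_assoc,
                  ← ENNReal.ofReal_mul (by positivity)]
                congr 2
                field_simp
      _ < ∞ := by
          rw [lintegral_const_mul _ (by fun_prop)]
          exact ENNReal.mul_lt_top ENNReal.ofReal_lt_top hD2
  have hamgm : ∀ a b p q : ℝ≥0∞, p * q = 1 → b * a ≤ b ^ 2 * p + a ^ 2 * q := by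
    intro a b p q hpq
    rcases le_total (b * p) a with h | h
    · calc b * a = (b * p) * (a * q) := by rw [mul_mul_mul_comm, hpq, mul_one]
        _ ≤ a * (a * q) := by gcongr
        _ = a ^ 2 * q := by ring
        _ ≤ _ := le_add_self
    · calc b * a ≤ b * (b * p) := by gcongr
        _ = b ^ 2 * p := by ring
        _ ≤ _ := le_self_add
  -- Translating z by e and then reflecting e shows that the A-term has the same form as the B-term.
  have h2 : ∫⁻ e, ∫⁻ z, A (z + e) ^ 2 * (v z * w (z + e)) * k e =
      ∫⁻ z, ∫⁻ e, A z ^ 2 * w z * v (z + e) * k e := by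
    calc _ = ∫⁻ e, ∫⁻ z, A z ^ 2 * (v (z - e) * w z) * k e := by
          refine lintegral_congr fun e => ?_
          rw [← lintegral_add_right_eq_self
            (fun z => A z ^ 2 * (v (z - e) * w z) * k e) e]
          simp
      _ = ∫⁻ z, ∫⁻ e, A z ^ 2 * (v (z - e) * w z) * k e :=
          lintegral_lintegral_swap (by fun_prop)
      _ = _ := by
          refine lintegral_congr fun z => ?_
          rw [← lintegral_neg_eq_self]
          refine lintegral_congr fun e => ?_
          simp only [k, norm_neg, sub_neg_eq_add]
          ring
  calc _ ≤ ∫⁻ e, ∫⁻ z, (B z ^ 2 * w z * v (z + e) * k e +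
        A (z + e) ^ 2 * (v z * w (z + e)) * k e) := by
        refine lintegral_mono fun e => lintegral_mono fun z => ?_
        rw [← add_mul]
        gcongr
        rw [mul_assoc]
        apply hamgm
        rw [mul_mul_mul_comm, hwv, mul_comm (v _), hwv, mul_one]
    _ = (∫⁻ e, ∫⁻ z, B z ^ 2 * w z * v (z + e) * k e) +
        ∫⁻ e, ∫⁻ z, A (z + e) ^ 2 * (v z * w (z + e)) * k e := by
        rw [← lintegral_add_left (by fun_prop)]
        refine lintegral_congr fun e => ?_
        rw [lintegral_add_left (by fun_prop)]
    _ < ∞ := by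
        rw [h2, lintegral_lintegral_swap (by fun_prop)]
        exact ENNReal.add_lt_top.mpr ⟨hsum B hB hB2, hsum A hA hA2⟩

/-! ### Young's inequality -/

/-- Young's inequality `L¹ * L² → L²`. -/
theorem lintegral_sq_lconvolution_le {A B : Space → ℝ≥0∞} (hA : Measurable A)
    (hB : Measurable B) :
    ∫⁻ x, (∫⁻ e, A e * B (x - e)) ^ 2 ≤ (∫⁻ e, A e) ^ 2 * ∫⁻ x, B x ^ 2 := by
  -- Cauchy–Schwarz after splitting A = A^(1/2) · A^(1/2); Tonelli then finishes.
  have hcs : ∀ x, (∫⁻ e, A e * B (x - e)) ^ 2 ≤ (∫⁻ e, A e) * ∫⁻ e, A e * B (x - e) ^ 2 := by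
    intro x
    have h := ENNReal.lintegral_mul_le_Lp_mul_Lq volume Real.HolderConjugate.two_two
      (f := fun e => A e ^ (1 / 2 : ℝ)) (g := fun e => A e ^ (1 / 2 : ℝ) * B (x - e))
      (by fun_prop) (by fun_prop)
    have h1 : ∀ a : ℝ≥0∞, a ^ (1 / 2 : ℝ) * a ^ (1 / 2 : ℝ) = a := fun a => by
      rw [← ENNReal.rpow_add_of_nonneg _ _ (by norm_num) (by norm_num)]
      norm_num
    have h3 : ∀ a : ℝ≥0∞, (a ^ (1 / 2 : ℝ)) ^ 2 = a := fun a => by rw [sq, h1]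
    simp only [Pi.mul_apply, ENNReal.rpow_two, mul_pow, h3, ← mul_assoc, h1] at h
    calc _ ≤ _ := pow_le_pow_left' h 2
      _ = _ := by rw [mul_pow, h3, h3]
  calc _ ≤ ∫⁻ x, (∫⁻ e, A e) * ∫⁻ e, A e * B (x - e) ^ 2 := lintegral_mono hcs
    _ = (∫⁻ e, A e) * ∫⁻ x, ∫⁻ e, A e * B (x - e) ^ 2 :=
        lintegral_const_mul _ (by fun_prop)
    _ = (∫⁻ e, A e) * ∫⁻ e, ∫⁻ x, A e * B (x - e) ^ 2 := by
        rw [lintegral_lintegral_swap (by fun_prop)]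
    _ = (∫⁻ e, A e) * ∫⁻ e, A e * ∫⁻ x, B x ^ 2 := by
        congr 1
        refine lintegral_congr fun e => ?_
        rw [lintegral_const_mul _ (by fun_prop),
          lintegral_sub_right_eq_self (fun x => B x ^ 2) e]
    _ = _ := by rw [lintegral_mul_const _ hA, sq, mul_assoc]

/-! ### Sobolev weights on the Fourier side -/

theorem toTemperedDistribution_injective {f g : Lp ℂ 2 (volume : Measure Space)}
    (h : (f : 𝓢'(Space, ℂ)) = (g : 𝓢'(Space, ℂ))) : f = g :=
  LinearMap.ker_eq_bot.mp
    (Lp.ker_toTemperedDistributionCLM_eq_bot (F := ℂ) (μ := (volume : Measure Space)) (p := 2)) h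

/-- The weight `(1 + ‖x‖²) ^ (t / 2)`. -/
noncomputable def weight (t : ℝ) (x : Space) : ℝ := (1 + ‖x‖ ^ 2) ^ (t / 2)

theorem weight_pos (t : ℝ) (x : Space) : 0 < weight t x := by unfold weight; positivity

theorem weight_add (s t : ℝ) (x : Space) : weight (s + t) x = weight s x * weight t x := by
  rw [weight, weight, weight, ← Real.rpow_add (by positivity), add_div]

theorem weight_zero (x : Space) : weight 0 x = 1 := by simp [weight]

theorem weight_hasTemperateGrowth (t : ℝ) :
    (fun x => (weight t x : ℂ)).HasTemperateGrowth := by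
  unfold weight
  fun_prop

@[fun_prop]
theorem continuous_weight (t : ℝ) : Continuous (weight t) := by
  unfold weight
  exact Continuous.rpow_const (by fun_prop) fun x => Or.inl (by positivity)

@[fun_prop]
theorem measurable_weight (t : ℝ) : Measurable (weight t) := (continuous_weight t).measurable

theorem one_le_weight {t : ℝ} (ht : 0 ≤ t) (x : Space) : 1 ≤ weight t x :=
  Real.one_le_rpow (by nlinarith [norm_nonneg x]) (by positivity)

/-- Peetre's inequality. -/
theorem weight_sub_le {t : ℝ} (ht : 0 ≤ t) (x y : Space) :
    weight t (x - y) ≤ 2 ^ (t / 2) * (weight t x * weight t y) := by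
  unfold weight
  rw [← Real.mul_rpow (by positivity) (by positivity), ← Real.mul_rpow (by positivity)
    (by positivity)]
  refine Real.rpow_le_rpow (by positivity) ?_ (by positivity)
  have h := norm_sub_le x y
  have h1 : ‖x - y‖ ^ 2 ≤ (‖x‖ + ‖y‖) ^ 2 := by gcongr
  nlinarith [sq_nonneg (‖x‖ - ‖y‖), mul_nonneg (sq_nonneg ‖x‖) (sq_nonneg ‖y‖)]

theorem one_add_norm_le_weight (x : Space) : 1 + ‖x‖ ≤ 2 * weight 1 x := by
  unfold weight
  rw [← Real.sqrt_eq_rpow]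
  have h1 : 1 ≤ √(1 + ‖x‖ ^ 2) := Real.one_le_sqrt.mpr (by nlinarith [norm_nonneg x])
  have h2 : ‖x‖ ≤ √(1 + ‖x‖ ^ 2) := Real.le_sqrt_of_sq_le (by linarith)
  linarith

/-- `MemSobolev` only gives an L² function equal to the weighted transform as a distribution. For s
≥ 0 the weight of order -s is bounded, so multiplying by it stays in L² and turns this into an
almost everywhere identity. -/
theorem lintegral_weight_mul_fourier_sq_lt_top {s : ℝ} (hs : 0 ≤ s)
    {a : Lp ℂ 2 (volume : Measure Space)} (ha : MemSobolev s 2 (a : 𝓢'(Space, ℂ))) :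
    ∫⁻ x, (ENNReal.ofReal (weight s x) * ‖(𝓕 a : Lp ℂ 2 (volume : Measure Space)) x‖ₑ) ^ 2
      < ∞ := by
  obtain ⟨f, hf⟩ := memSobolev_iff_exists_smulLeftCLM_fourier.mp ha
  have hf : smulLeftCLM ℂ (fun x => (weight s x : ℂ)) (𝓕 (a : 𝓢'(Space, ℂ))) = f := hf
  rw [Lp.fourier_toTemperedDistribution_eq] at hf
  have hbdd : MemLp (fun x => (weight (-s) x : ℂ)) ∞ (volume : Measure Space) := by
    refine memLp_top_of_bound (by fun_prop) 1 (ae_of_all _ fun x => ?_)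
    rw [Complex.norm_real, Real.norm_of_nonneg (weight_pos _ _).le]
    exact Real.rpow_le_one_of_one_le_of_nonpos (by nlinarith [norm_nonneg x]) (by linarith)
  have heq : (hbdd.toLp _ • f : Lp ℂ 2 (volume : Measure Space)) = 𝓕 a := by
    apply toTemperedDistribution_injective
    rw [Lp.toTemperedDistribution_smul_eq (weight_hasTemperateGrowth _), ← hf,
      smulLeftCLM_smulLeftCLM_apply (weight_hasTemperateGrowth _) (weight_hasTemperateGrowth _)]
    convert! smulLeftCLM_const (1 : ℂ) (((𝓕 a : Lp ℂ 2 (volume : Measure Space))) : 𝓢'(Space, ℂ))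
      using 3
    · funext x
      rw [Pi.mul_apply, ← Complex.ofReal_mul, ← weight_add, add_neg_cancel, weight_zero,
        Complex.ofReal_one]
    · simp
  have hf2 : ∫⁻ x, ‖f x‖ₑ ^ 2 < ∞ := by
    have := lintegral_rpow_enorm_lt_top_of_eLpNorm_lt_top (by norm_num) (by norm_num)
      (Lp.memLp f).2
    simpa using this
  refine lt_of_le_of_lt (le_of_eq (lintegral_congr_ae ?_)) hf2
  rw [← heq]
  filter_upwards [Lp.coeFn_lpSMul (r := 2) (hbdd.toLp _) f, hbdd.coeFn_toLp] with x hx hx'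
  rw [hx, Pi.smul_apply', hx', enorm_smul, ← ofReal_norm (weight (-s) x : ℂ), Complex.norm_real,
    Real.norm_of_nonneg (weight_pos _ _).le, ← mul_assoc,
    ← ENNReal.ofReal_mul (weight_pos _ _).le, ← weight_add, add_neg_cancel, weight_zero]
  simp

theorem memSobolev_fourierInv {t : ℝ} {W : Lp ℂ 2 (volume : Measure Space)}
    (hW : ∫⁻ x, (ENNReal.ofReal (weight t x) * ‖W x‖ₑ) ^ 2 < ∞) :
    MemSobolev t 2 (𝓕⁻ (W : 𝓢'(Space, ℂ))) := by
  rw [memSobolev_iff_exists_smulLeftCLM_fourier]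
  have hm : MemLp (fun x => (weight t x : ℂ) * W x) 2 (volume : Measure Space) := by
    refine ⟨by fun_prop, ?_⟩
    rw [eLpNorm_lt_top_iff_lintegral_rpow_enorm_lt_top (by norm_num) (by norm_num)]
    refine lt_of_le_of_lt (le_of_eq (lintegral_congr fun x => ?_)) hW
    rw [enorm_mul, ← ofReal_norm (weight t x : ℂ), Complex.norm_real,
      Real.norm_of_nonneg (weight_pos _ _).le]
    simp
  refine ⟨hm.toLp _, ?_⟩
  change smulLeftCLM ℂ (fun x => (weight t x : ℂ)) _ = _
  ext u
  rw [FourierTransform.fourier_fourierInv_eq, smulLeftCLM_apply_apply,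
    Lp.toTemperedDistribution_apply, Lp.toTemperedDistribution_apply]
  refine integral_congr_ae ?_
  filter_upwards [hm.coeFn_toLp] with x hx
  rw [hx, SchwartzMap.smulLeftCLM_apply_apply (weight_hasTemperateGrowth t)]
  simp only [smul_eq_mul]
  ring

/-! ### Modulation and the transform of a product -/

/-- The character `x ↦ exp (2πi ⟪x, e⟫)`. -/
noncomputable def chi (e x : Space) : ℂ :=
  Complex.exp ((2 * Real.pi * inner ℝ x e : ℝ) * Complex.I)

@[simp]
theorem norm_chi (e x : Space) : ‖chi e x‖ = 1 := Complex.norm_exp_ofReal_mul_I _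

theorem continuous_chi_uncurry : Continuous fun p : Space × Space => chi p.1 p.2 := by
  unfold chi
  fun_prop

@[fun_prop]
theorem continuous_chi (e : Space) : Continuous (chi e) :=
  continuous_chi_uncurry.comp (by fun_prop : Continuous fun x : Space => (e, x))

@[fun_prop]
theorem measurable_chi (e : Space) : Measurable (chi e) := (continuous_chi e).measurable

theorem chi_comm (e x : Space) : chi e x = chi x e := by
  rw [chi, chi, real_inner_comm]

theorem chi_add_left (e f x : Space) : chi (e + f) x = chi e x * chi f x := by
  rw [chi, chi, chi, ← Complex.exp_add, inner_add_right]
  congr 1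
  push_cast
  ring

theorem fourier_eq_integral_chi (f : Space → ℂ) (x : Space) :
    𝓕 f x = ∫ z, chi (-x) z * f z := by
  rw [Real.fourier_eq']
  refine integral_congr_ae (ae_of_all _ fun z => ?_)
  simp only [chi, inner_neg_right, smul_eq_mul]
  congr 4
  ring

theorem fourier_compSubConst_apply (u : 𝓢(Space, ℂ)) (e x : Space) :
    𝓕 (u.compSubConstCLM ℂ (-e)) x = chi e x * 𝓕 u x := by
  rw [SchwartzMap.fourier_coe, SchwartzMap.fourier_coe, fourier_eq_integral_chi,
    fourier_eq_integral_chi, ← integral_const_mul, ← integral_add_right_eq_self _ (-e)]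
  refine integral_congr_ae (ae_of_all _ fun z => ?_)
  simp only [SchwartzMap.compSubConstCLM_apply, sub_neg_eq_add, neg_add_cancel_right]
  rw [chi_comm _ (z + -e), chi_add_left, chi_comm z, chi_comm e x, ← mul_assoc]
  congr 1
  rw [mul_comm]
  congr 1
  simp [chi, inner_neg_left, inner_neg_right, real_inner_comm]

/-- Translation on the Fourier side is modulation. -/
theorem integral_modulate_fourier_mul (a : Lp ℂ 2 (volume : Measure Space)) (u : 𝓢(Space, ℂ))
    (e : Space) :
    ∫ x, chi e x * 𝓕 u x * a x =
      ∫ z, u (z + e) * (𝓕 a : Lp ℂ 2 (volume : Measure Space)) z := by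
  have h := congrArg (fun T : 𝓢'(Space, ℂ) => T (u.compSubConstCLM ℂ (-e)))
    (Lp.fourier_toTemperedDistribution_eq a)
  simp only [TemperedDistribution.fourier_apply, Lp.toTemperedDistribution_apply, smul_eq_mul,
    fourier_compSubConst_apply, SchwartzMap.compSubConstCLM_apply, sub_neg_eq_add] at h
  exact h

theorem memLp_modulate (a : Lp ℂ 2 (volume : Measure Space)) (e : Space) :
    MemLp (fun x => chi e x * a x) 2 (volume : Measure Space) := by
  refine (Lp.memLp a).of_le (by fun_prop) (ae_of_all _ fun x => ?_)
  simp

/-- The L² transform has no integral formula to shift, so the identity is tested against Schwartz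
functions, where the modulation becomes a translation of the test function. -/
theorem fourier_modulate_ae (a : Lp ℂ 2 (volume : Measure Space)) (e : Space) :
    (𝓕 ((memLp_modulate a (-e)).toLp _) : Lp ℂ 2 (volume : Measure Space)) =ᵐ[volume]
      fun z => (𝓕 a : Lp ℂ 2 (volume : Measure Space)) (z + e) := by
  have hm : MemLp (fun z => (𝓕 a : Lp ℂ 2 (volume : Measure Space)) (z + e)) 2
      (volume : Measure Space) :=
    (Lp.memLp (𝓕 a)).comp_measurePreserving (measurePreserving_add_right volume e)
  have h : (𝓕 ((memLp_modulate a (-e)).toLp _) : Lp ℂ 2 (volume : Measure Space)) =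
      hm.toLp _ := by
    apply toTemperedDistribution_injective
    ext u
    rw [← Lp.fourier_toTemperedDistribution_eq, TemperedDistribution.fourier_apply, Lp.toTemperedDistribution_apply,
      Lp.toTemperedDistribution_apply]
    calc _ = ∫ x, chi (-e) x * 𝓕 u x * a x := by
          refine integral_congr_ae ?_
          filter_upwards [(memLp_modulate a (-e)).coeFn_toLp] with x hx
          rw [hx, smul_eq_mul]
          ring
      _ = ∫ z, u (z + -e) * (𝓕 a : Lp ℂ 2 (volume : Measure Space)) z :=
          integral_modulate_fourier_mul a u (-e)
      _ = ∫ z, u z * (𝓕 a : Lp ℂ 2 (volume : Measure Space)) (z + e) := by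
          rw [← integral_add_right_eq_self _ e]
          simp
      _ = _ := by
          refine integral_congr_ae ?_
          filter_upwards [hm.coeFn_toLp] with x hx
          rw [hx, smul_eq_mul]
  rw [h]
  exact hm.coeFn_toLp

/-- The Fourier transform of `a * conj b` is bounded by a correlation of the transforms. -/
theorem enorm_fourier_mul_conj_le (a b : Lp ℂ 2 (volume : Measure Space)) (e : Space) :
    ‖𝓕 (fun x => a x * (starRingEnd ℂ) (b x)) e‖ₑ ≤
      ∫⁻ z, ‖(𝓕 b : Lp ℂ 2 (volume : Measure Space)) z‖ₑ *
        ‖(𝓕 a : Lp ℂ 2 (volume : Measure Space)) (z + e)‖ₑ := by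
  -- The transform at e is the inner product of b with a modulated a, so Plancherel applies.
  have h1 : 𝓕 (fun x => a x * (starRingEnd ℂ) (b x)) e =
      inner ℂ b ((memLp_modulate a (-e)).toLp _) := by
    rw [L2.inner_def, fourier_eq_integral_chi]
    refine integral_congr_ae ?_
    filter_upwards [(memLp_modulate a (-e)).coeFn_toLp] with x hx
    rw [hx]
    simp only [RCLike.inner_apply]
    ring
  rw [h1, ← Lp.inner_fourier_eq, L2.inner_def]
  refine (enorm_integral_le_lintegral_enorm _).trans (le_of_eq (lintegral_congr_ae ?_))
  filter_upwards [fourier_modulate_ae a e] with z hz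
  rw [hz]
  simp only [RCLike.inner_apply, enorm_mul]
  rw [mul_comm]
  congr 1
  exact RCLike.enorm_conj _

/-! ### Fourier representation of the Newtonian potential -/

/-- A Gamma integral at 1/2; with c = |y| it writes the Coulomb kernel as a superposition of
Gaussians. -/
theorem integral_gaussian_superposition_inv {c : ℝ} (hc : 0 < c) :
    ∫ t in Set.Ioi (0 : ℝ), t ^ (-1 / 2 : ℝ) * Real.exp (-(Real.pi * c ^ 2 * t)) = 1 / c := by
  have h := Real.integral_rpow_mul_exp_neg_mul_Ioi (a := 1 / 2) (r := Real.pi * c ^ 2)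
    (by norm_num) (by positivity)
  rw [show (1 / 2 - 1 : ℝ) = -1 / 2 by norm_num] at h
  rw [h, Real.Gamma_one_half_eq, ← Real.sqrt_eq_rpow, ← Real.sqrt_mul (by positivity),
    show 1 / (Real.pi * c ^ 2) * Real.pi = (1 / c) ^ 2 by field_simp,
    Real.sqrt_sq (by positivity)]

/-- Substitute u = 1/t. With c = π|e|² this sums the transformed Gaussians to the symbol of the
potential. -/
theorem integral_gaussian_superposition_inv_sq {c : ℝ} (hc : 0 < c) :
    ∫ t in Set.Ioi (0 : ℝ), t ^ (-2 : ℝ) * Real.exp (-(c * t ^ (-1 : ℝ))) = c⁻¹ := by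
  have h := integral_comp_rpow_Ioi (fun u => Real.exp (-(c * u))) (p := -1) (by norm_num)
  have h2 := Real.integral_rpow_mul_exp_neg_mul_Ioi (a := 1) (r := c) (by norm_num) hc
  simp only [sub_self, Real.rpow_zero, one_mul, Real.rpow_one, Real.Gamma_one, mul_one] at h2
  rw [h2] at h
  rw [← one_div, ← h]
  norm_num

/-- Fubini for a superposition `K y = ∫ k t y dt` of nonnegative kernels. -/
theorem integral_superposition_mul {k : ℝ → Space → ℝ} {K : Space → ℝ} {g : Space → ℂ}
    (hk : Measurable fun p : ℝ × Space => k p.1 p.2) (hk0 : ∀ t > 0, ∀ y, 0 ≤ k t y)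
    (hK0 : ∀ y ≠ 0, K y ≠ 0) (hK : ∀ y ≠ 0, ∫ t in Set.Ioi (0 : ℝ), k t y = K y)
    (hg : AEStronglyMeasurable g) (hint : Integrable fun y => (K y : ℂ) * g y) :
    ∫ y, (K y : ℂ) * g y = ∫ t in Set.Ioi (0 : ℝ), ∫ y, (k t y : ℂ) * g y := by
  have hne : ∀ᵐ y : Space, y ≠ 0 := by simp [ae_iff]
  -- The Bochner integral of a non-integrable function is 0 by default, so a nonzero integral forces
  -- integrability.
  have hki : ∀ y ≠ 0, IntegrableOn (fun t => k t y) (Set.Ioi 0) := fun y hy =>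
    Integrable.of_integral_ne_zero (by rw [hK y hy]; exact hK0 y hy)
  have hprod : Integrable (Function.uncurry fun (t : ℝ) (y : Space) => (k t y : ℂ) * g y)
      ((volume.restrict (Set.Ioi (0 : ℝ))).prod volume) := by
    rw [integrable_prod_iff']
    · refine ⟨?_, ?_⟩
      · filter_upwards [hne] with y hy
        exact ((hki y hy).ofReal (𝕜 := ℂ)).mul_const (g y)
      · refine hint.norm.congr ?_
        filter_upwards [hne] with y hy
        simp only [Function.uncurry, norm_mul, Complex.norm_real]
        rw [integral_mul_const]
        congr 1
        have : ∀ t ∈ Set.Ioi (0 : ℝ), ‖k t y‖ = k t y := fun t ht =>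
          Real.norm_of_nonneg (hk0 t ht y)
        rw [setIntegral_congr_fun measurableSet_Ioi this, hK y hy, Real.norm_of_nonneg]
        rw [← hK y hy]
        exact setIntegral_nonneg measurableSet_Ioi fun t ht => hk0 t ht y
    · exact (Complex.measurable_ofReal.comp hk).aestronglyMeasurable.mul hg.comp_snd
  rw [integral_integral_swap hprod]
  refine integral_congr_ae ?_
  filter_upwards [hne] with y hy
  rw [integral_mul_const, integral_complex_ofReal, hK y hy]

/-- Move the Fourier transform from a modulated Gaussian J to f: 𝓕 J is t^(3/2) times the Gaussian
centred at x, with 3/2 half the dimension. -/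
theorem integral_gaussian_mul_eq {f : Space → ℂ} (hf : Integrable f) {t : ℝ} (ht : 0 < t)
    (x : Space) :
    ∫ y, (Real.exp (-(Real.pi * ‖y‖ ^ 2 * t)) : ℂ) * f (x - y) =
      ∫ e, ((t ^ (-3 / 2 : ℝ) * Real.exp (-(Real.pi * ‖e‖ ^ 2 * t ^ (-1 : ℝ))) : ℝ) : ℂ) *
        (chi x e * 𝓕 f e) := by
  have hb : 0 < ((Real.pi / t : ℝ) : ℂ).re := by
    rw [Complex.ofReal_re]
    positivity
  set J : Space → ℂ := fun v => Complex.exp (-((Real.pi / t : ℝ) : ℂ) * ‖v‖ ^ 2 +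
    2 * Real.pi * Complex.I * inner ℝ x v)
  have hJ : Integrable J := GaussianFourier.integrable_cexp_neg_mul_sq_norm_add hb _ _
  have hFJ : ∀ z, 𝓕 J z = ((t ^ (3 / 2 : ℝ) : ℝ) : ℂ) *
      (Real.exp (-(Real.pi * ‖x - z‖ ^ 2 * t)) : ℂ) := by
    intro z
    rw [fourier_gaussian_innerProductSpace' hb]
    congr 1
    · rw [finrank_euclideanSpace, Fintype.card_fin, ← Complex.ofReal_div,
        show Real.pi / (Real.pi / t) = t by field_simp, Complex.ofReal_cpow ht.le]
      norm_num
    · rw [Complex.ofReal_exp]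
      congr 1
      push_cast
      have : (t : ℂ) ≠ 0 := by exact_mod_cast ht.ne'
      have : (Real.pi : ℂ) ≠ 0 := by exact_mod_cast Real.pi_ne_zero
      field_simp
  have hpar : ∫ z, 𝓕 J z • f z = ∫ v, J v • 𝓕 f v := by
    simpa using! VectorFourier.integral_fourierIntegral_smul_eq_flip (L := innerₗ Space)
      Real.continuous_fourierChar continuous_inner hJ hf
  have hJ2 : ∀ e, J e = (Real.exp (-(Real.pi * ‖e‖ ^ 2 * t ^ (-1 : ℝ))) : ℂ) * chi x e := by
    intro e
    rw [chi, Complex.ofReal_exp, ← Complex.exp_add, Real.rpow_neg_one]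
    simp only [J]
    congr 1
    rw [real_inner_comm]
    push_cast
    ring
  have hts : ((t ^ (-3 / 2 : ℝ) : ℝ) : ℂ) * ((t ^ (3 / 2 : ℝ) : ℝ) : ℂ) = 1 := by
    rw [← Complex.ofReal_mul, ← Real.rpow_add ht]
    norm_num
  calc _ = ∫ z, (Real.exp (-(Real.pi * ‖x - z‖ ^ 2 * t)) : ℂ) * f z := by
        rw [← integral_sub_left_eq_self _ volume x]
        simp
    _ = ((t ^ (-3 / 2 : ℝ) : ℝ) : ℂ) * ∫ z, 𝓕 J z • f z := by
        rw [← integral_const_mul]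
        refine integral_congr_ae (ae_of_all _ fun z => ?_)
        simp only [hFJ, smul_eq_mul]
        rw [← mul_assoc, ← mul_assoc, hts, one_mul]
    _ = _ := by
        rw [hpar, ← integral_const_mul]
        refine integral_congr_ae (ae_of_all _ fun e => ?_)
        simp only [hJ2, smul_eq_mul]
        push_cast
        ring

/-- The kernel satisfies 1/|y| ≤ 2 r(y) + 1 with r integrable. The r-part converges for almost every
x by Tonelli, the constant part because f is integrable. -/
theorem ae_integrable_newton {f : Space → ℂ} (hfm : Measurable f) (hf : Integrable f) :
    ∀ᵐ x, Integrable fun y : Space => ((1 / ‖y‖ : ℝ) : ℂ) * f (x - y) := by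
  set r : Space → ℝ := fun y => (‖y‖ ^ 2 * (1 + ‖y‖ ^ 2))⁻¹
  have hr : Integrable r := integrable_radial_one
  have hconv : ∀ᵐ x, ∫⁻ y, ENNReal.ofReal (r y) * ‖f (x - y)‖ₑ < ∞ := by
    have hm : Measurable fun x => ∫⁻ y, ENNReal.ofReal (r y) * ‖f (x - y)‖ₑ := by
      refine Measurable.lintegral_prod_right ?_
      fun_prop
    refine ae_lt_top hm (ne_of_lt ?_)
    rw [lintegral_lintegral_swap (by fun_prop)]
    calc _ = ∫⁻ y, ENNReal.ofReal (r y) * ∫⁻ x, ‖f x‖ₑ := by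
          refine lintegral_congr fun y => ?_
          rw [lintegral_const_mul _ (by fun_prop),
            lintegral_sub_right_eq_self (fun x => ‖f x‖ₑ) y]
      _ < ∞ := by
          rw [lintegral_mul_const _ (by fun_prop)]
          exact ENNReal.mul_lt_top hr.lintegral_lt_top hf.2
  have hne : ∀ᵐ y : Space, y ≠ 0 := by simp [ae_iff]
  filter_upwards [hconv] with x hx
  have h1 : Integrable fun y => (r y : ℂ) * f (x - y) := by
    refine ⟨by fun_prop, lt_of_le_of_lt (le_of_eq (lintegral_congr fun y => ?_)) hx⟩
    rw [enorm_mul, ← ofReal_norm (r y : ℂ), Complex.norm_real,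
      Real.norm_of_nonneg (by positivity)]
  refine ((h1.norm.const_mul 2).add (hf.comp_sub_left x).norm).mono' (by fun_prop) ?_
  filter_upwards [hne] with y hy
  have hy : 0 < ‖y‖ := norm_pos_iff.mpr hy
  simp only [Pi.add_apply, norm_mul, Complex.norm_real]
  rw [Real.norm_of_nonneg (by positivity), Real.norm_of_nonneg (show 0 ≤ r y by positivity),
    ← mul_assoc, ← add_one_mul]
  gcongr
  simp only [r]
  rcases le_total 1 ‖y‖ with h | h
  · have : 1 / ‖y‖ ≤ 1 := by rwa [div_le_one hy]
    have : 0 ≤ (‖y‖ ^ 2 * (1 + ‖y‖ ^ 2))⁻¹ := by positivity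
    linarith
  · have : 1 / ‖y‖ ≤ 2 * (‖y‖ ^ 2 * (1 + ‖y‖ ^ 2))⁻¹ := by
      rw [← div_eq_mul_inv, div_le_div_iff₀ hy (by positivity)]
      nlinarith [mul_le_mul h h hy.le zero_le_one]
    linarith

/-- The Newtonian potential of `f` is the inverse Fourier transform of `𝓕 f / (π ‖·‖²)`. -/
theorem newton_ae_eq {f : Space → ℂ} (hfm : Measurable f) (hf : Integrable f)
    (hV : Integrable fun e => (((Real.pi * ‖e‖ ^ 2)⁻¹ : ℝ) : ℂ) * 𝓕 f e) :
    newton f =ᵐ[volume]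
      fun x => ∫ e, chi x e * ((((Real.pi * ‖e‖ ^ 2)⁻¹ : ℝ) : ℂ) * 𝓕 f e) := by
  have hFm : Continuous (𝓕 f) := VectorFourier.fourierIntegral_continuous
    Real.continuous_fourierChar continuous_inner hf
  filter_upwards [ae_integrable_newton hfm hf] with x hx
  -- Both sides become integrals over t. The Gaussian identity matches them for each t, since
  -- t^(-1/2) · t^(-3/2) = t^(-2).
  have hleft := integral_superposition_mul
    (k := fun t y => t ^ (-1 / 2 : ℝ) * Real.exp (-(Real.pi * ‖y‖ ^ 2 * t)))
    (K := fun y => 1 / ‖y‖) (g := fun y => f (x - y)) (by fun_prop)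
    (fun t ht y => by positivity)
    (fun y hy => by simpa using hy)
    (fun y hy => integral_gaussian_superposition_inv (norm_pos_iff.mpr hy))
    (hfm.comp (measurable_const.sub measurable_id)).aestronglyMeasurable hx
  have hright := integral_superposition_mul
    (k := fun t e => t ^ (-2 : ℝ) * Real.exp (-(Real.pi * ‖e‖ ^ 2 * t ^ (-1 : ℝ))))
    (K := fun e => (Real.pi * ‖e‖ ^ 2)⁻¹) (g := fun e => chi x e * 𝓕 f e) (by fun_prop)
    (fun t ht y => by positivity)
    (fun y hy => by simpa [Real.pi_ne_zero] using hy)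
    (fun y hy => integral_gaussian_superposition_inv_sq (by
      have := norm_pos_iff.mpr hy
      positivity)) (by fun_prop) (by
      refine hV.mono (by fun_prop) (ae_of_all _ fun e => ?_)
      simp)
  calc newton f x = ∫ y, ((1 / ‖y‖ : ℝ) : ℂ) * f (x - y) := rfl
    _ = ∫ e, (((Real.pi * ‖e‖ ^ 2)⁻¹ : ℝ) : ℂ) * (chi x e * 𝓕 f e) := by
        rw [hleft, hright]
        refine setIntegral_congr_fun measurableSet_Ioi fun t ht => ?_
        have ht : 0 < t := ht
        have hg := integral_gaussian_mul_eq hf ht x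
        calc _ = ((t ^ (-1 / 2 : ℝ) : ℝ) : ℂ) *
              ∫ y, (Real.exp (-(Real.pi * ‖y‖ ^ 2 * t)) : ℂ) * f (x - y) := by
              rw [← integral_const_mul]
              refine integral_congr_ae (ae_of_all _ fun y => ?_)
              push_cast
              ring
          _ = _ := by
              rw [hg, ← integral_const_mul]
              refine integral_congr_ae (ae_of_all _ fun e => ?_)
              simp only
              rw [← mul_assoc ((t ^ (-1 / 2 : ℝ) : ℝ) : ℂ), ← Complex.ofReal_mul,
                ← mul_assoc (t ^ (-1 / 2 : ℝ)), ← Real.rpow_add ht]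
              norm_num
    _ = _ := integral_congr_ae (ae_of_all _ fun e => by ring)

/-! ### The trilinear estimate -/

theorem measurable_coe_lp (a : Lp ℂ 2 (volume : Measure Space)) : Measurable a :=
  (Lp.stronglyMeasurable a).measurable

theorem integrable_mul_conj (a b : Lp ℂ 2 (volume : Measure Space)) :
    Integrable fun x => a x * (starRingEnd ℂ) (b x) :=
  (Lp.memLp a).integrable_mul (Lp.memLp b).star

/-- Peetre's inequality for e = (z+e) - z gives each factor a weight of order t. The remaining half
derivative of a and of b supplies the factor 1 + |z| in Kato's inequality. -/
theorem lintegral_weight_mul_fourier_mul_conj_lt_top {s : ℝ} (hs : 1 / 2 ≤ s)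
    {a b : Lp ℂ 2 (volume : Measure Space)} (ha : MemSobolev s 2 (a : 𝓢'(Space, ℂ)))
    (hb : MemSobolev s 2 (b : 𝓢'(Space, ℂ))) :
    ∫⁻ e, ENNReal.ofReal (weight (s - 1 / 2) e) *
      ‖(((Real.pi * ‖e‖ ^ 2)⁻¹ : ℝ) : ℂ) * 𝓕 (fun x => a x * (starRingEnd ℂ) (b x)) e‖ₑ < ∞ := by
  set t := s - 1 / 2 with ht_def
  have ht : 0 ≤ t := by linarith
  set D : Lp ℂ 2 (volume : Measure Space) → Space → ℝ≥0∞ := fun a z =>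
    ENNReal.ofReal (weight t z) * ‖(𝓕 a : Lp ℂ 2 (volume : Measure Space)) z‖ₑ
  have hD : ∀ a, Measurable (D a) := fun a => by
    have := measurable_coe_lp (𝓕 a)
    fun_prop
  have hD2 : ∀ a : Lp ℂ 2 (volume : Measure Space), MemSobolev s 2 (a : 𝓢'(Space, ℂ)) →
      ∫⁻ z, ENNReal.ofReal (1 + ‖z‖) * D a z ^ 2 < ∞ := by
    intro a ha
    have hm := measurable_coe_lp (𝓕 a)
    calc _ ≤ ∫⁻ z, ENNReal.ofReal 2 * (ENNReal.ofReal (weight s z) *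
          ‖(𝓕 a : Lp ℂ 2 (volume : Measure Space)) z‖ₑ) ^ 2 := by
          refine lintegral_mono fun z => ?_
          simp only [D]
          rw [mul_pow, mul_pow, ← mul_assoc, ← mul_assoc, ← ENNReal.ofReal_pow (weight_pos _ _).le,
            ← ENNReal.ofReal_pow (weight_pos _ _).le, ← ENNReal.ofReal_mul (by positivity),
            ← ENNReal.ofReal_mul (by positivity)]
          gcongr ENNReal.ofReal ?_ * _
          have h1 : weight s z ^ 2 = weight 1 z * weight t z ^ 2 := by
            rw [sq, sq, ← weight_add, ← weight_add, ← weight_add]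
            congr 1
            rw [ht_def]
            ring
          rw [h1, ← mul_assoc]
          gcongr
          exact one_add_norm_le_weight z
      _ < ∞ := by
          rw [lintegral_const_mul _ (by fun_prop)]
          exact ENNReal.mul_lt_top ENNReal.ofReal_lt_top
            (lintegral_weight_mul_fourier_sq_lt_top (by linarith) ha)
  have hK := lintegral_lintegral_inv_sq_lt_top (hD a) (hD b) (hD2 a ha) (hD2 b hb)
  have hDa := hD a
  have hDb := hD b
  have hca := measurable_coe_lp (𝓕 a)
  have hcb := measurable_coe_lp (𝓕 b)
  calc _ ≤ ∫⁻ e : Space, ENNReal.ofReal (2 ^ (t / 2) * Real.pi⁻¹) *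
        ∫⁻ z, D b z * D a (z + e) * ENNReal.ofReal (‖e‖ ^ 2)⁻¹ := by
        refine lintegral_mono fun e => ?_
        rw [enorm_mul, ← ofReal_norm (((Real.pi * ‖e‖ ^ 2)⁻¹ : ℝ) : ℂ), Complex.norm_real,
          Real.norm_of_nonneg (by positivity), ← mul_assoc,
          ← ENNReal.ofReal_mul (weight_pos _ _).le]
        calc _ ≤ ENNReal.ofReal (weight t e * (Real.pi * ‖e‖ ^ 2)⁻¹) *
              ∫⁻ z, ‖(𝓕 b : Lp ℂ 2 (volume : Measure Space)) z‖ₑ *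
                ‖(𝓕 a : Lp ℂ 2 (volume : Measure Space)) (z + e)‖ₑ := by
              gcongr
              exact enorm_fourier_mul_conj_le a b e
          _ ≤ _ := by
              rw [← lintegral_const_mul _ (by fun_prop), ← lintegral_const_mul _ (by fun_prop)]
              refine lintegral_mono fun z => ?_
              have hw : weight t e * (Real.pi * ‖e‖ ^ 2)⁻¹ ≤ 2 ^ (t / 2) * Real.pi⁻¹ *
                  weight t z * weight t (z + e) * (‖e‖ ^ 2)⁻¹ := by
                have h := weight_sub_le ht (z + e) z
                rw [add_sub_cancel_left] at h
                calc _ ≤ 2 ^ (t / 2) * (weight t (z + e) * weight t z) *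
                      (Real.pi * ‖e‖ ^ 2)⁻¹ := by gcongr
                  _ = _ := by
                      rw [mul_inv]
                      ring
              have hwz := (weight_pos t z).le
              have hwze := (weight_pos t (z + e)).le
              calc _ ≤ ENNReal.ofReal (2 ^ (t / 2) * Real.pi⁻¹ *
                  weight t z * weight t (z + e) * (‖e‖ ^ 2)⁻¹) * (‖(𝓕 b : Lp ℂ 2 (volume : Measure Space)) z‖ₑ *
                    ‖(𝓕 a : Lp ℂ 2 (volume : Measure Space)) (z + e)‖ₑ) := by gcongr
                _ = _ := by
                  rw [ENNReal.ofReal_mul (by positivity), ENNReal.ofReal_mul (by positivity),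
                    ENNReal.ofReal_mul (by positivity)]
                  simp only [D]
                  ring
    _ < ∞ := by
        rw [lintegral_const_mul _ (by fun_prop)]
        exact ENNReal.mul_lt_top ENNReal.ofReal_lt_top hK

theorem lintegral_weight_mul_convolution_sq_lt_top {t : ℝ} (ht : 0 ≤ t) {V c : Space → ℂ}
    (hVm : Measurable V) (hcm : Measurable c)
    (hV : ∫⁻ e, ENNReal.ofReal (weight t e) * ‖V e‖ₑ < ∞)
    (hc : ∫⁻ x, (ENNReal.ofReal (weight t x) * ‖c x‖ₑ) ^ 2 < ∞) :
    ∫⁻ x, (ENNReal.ofReal (weight t x) * ∫⁻ e, ‖V e‖ₑ * ‖c (x - e)‖ₑ) ^ 2 < ∞ := by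
  set A : Space → ℝ≥0∞ := fun e => ENNReal.ofReal (weight t e) * ‖V e‖ₑ
  set B : Space → ℝ≥0∞ := fun x => ENNReal.ofReal (weight t x) * ‖c x‖ₑ
  have hA : Measurable A := by fun_prop
  have hB : Measurable B := by fun_prop
  calc _ ≤ ∫⁻ x, ENNReal.ofReal (2 ^ (t / 2)) ^ 2 * (∫⁻ e, A e * B (x - e)) ^ 2 := by
        refine lintegral_mono fun x => ?_
        rw [← mul_pow]
        gcongr ?_ ^ 2
        rw [← lintegral_const_mul _ (by fun_prop), ← lintegral_const_mul _ (by fun_prop)]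
        refine lintegral_mono fun e => ?_
        have hw : weight t x ≤ 2 ^ (t / 2) * (weight t e * weight t (x - e)) := by
          have h := weight_sub_le ht (x - e) (-e)
          rw [sub_neg_eq_add, sub_add_cancel] at h
          rw [mul_comm (weight t e)]
          simpa [weight] using h
        calc _ ≤ ENNReal.ofReal (2 ^ (t / 2) * (weight t e * weight t (x - e))) *
              (‖V e‖ₑ * ‖c (x - e)‖ₑ) := by gcongr
          _ = _ := by
              rw [ENNReal.ofReal_mul (by positivity), ENNReal.ofReal_mul (weight_pos _ _).le]
              simp only [A, B]
              ring
    _ < ∞ := by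
        rw [lintegral_const_mul _ (by fun_prop)]
        refine ENNReal.mul_lt_top (by simp) (lt_of_le_of_lt
          (lintegral_sq_lconvolution_le hA hB) (ENNReal.mul_lt_top ?_ hc))
        exact ENNReal.pow_lt_top hV

theorem enorm_convolution_le (V c : Space → ℂ) (x : Space) :
    ‖∫ e, V e * c (x - e)‖ₑ ≤ ∫⁻ e, ‖V e‖ₑ * ‖c (x - e)‖ₑ := by
  refine (enorm_integral_le_lintegral_enorm _).trans (le_of_eq (lintegral_congr fun e => ?_))
  rw [enorm_mul]

/-- The convolution theorem in weak form: for fixed e, modulation by e translates 𝓕 c. The first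
Fubini exchange uses u c ∈ L¹ and V ∈ L¹; the second pairs 𝓕⁻ u ∈ L² with |V| * |𝓕 c| ∈ L², by
Young. -/
theorem integral_mul_chi_integral_mul {V : Space → ℂ} (hVm : Measurable V) (hV : Integrable V)
    (c : Lp ℂ 2 (volume : Measure Space)) (u : 𝓢(Space, ℂ)) :
    ∫ x, u x * ((∫ e, chi x e * V e) * c x) =
      ∫ z, 𝓕⁻ u z * ∫ e, V e * (𝓕 c : Lp ℂ 2 (volume : Measure Space)) (z - e) := by
  set d : Lp ℂ 2 (volume : Measure Space) := 𝓕 c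
  set v : 𝓢(Space, ℂ) := 𝓕⁻ u
  have huv : 𝓕 v = u := FourierTransform.fourier_fourierInv_eq u
  have hdm := measurable_coe_lp d
  have hvm : Measurable v := v.continuous.measurable
  have huc : Integrable fun x => u x * c x := (u.memLp 2).integrable_mul (Lp.memLp c)
  have h1 : Integrable (Function.uncurry fun x e => u x * c x * (chi x e * V e))
      ((volume : Measure Space).prod volume) := by
    refine (huc.mul_prod hV).mono ?_ (ae_of_all _ fun p => ?_)
    · have := continuous_chi_uncurry.measurable
      have := measurable_coe_lp c
      have := u.continuous.measurable
      refine Measurable.aestronglyMeasurable ?_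
      simp only [Function.uncurry_def]
      fun_prop
    · simp [Function.uncurry]
  have h2 : Integrable (Function.uncurry fun e z => v z * (V e * d (z - e)))
      ((volume : Measure Space).prod volume) := by
    refine ⟨Measurable.aestronglyMeasurable ?_, ?_⟩
    · simp only [Function.uncurry_def]
      fun_prop
    have hsq : ∀ a b : ℝ≥0∞, a * b ≤ a ^ 2 + b ^ 2 := by
      intro a b
      rcases le_total a b with h | h
      · calc a * b ≤ b * b := by gcongr
          _ ≤ _ := by rw [← sq]; exact le_add_self
      · calc a * b ≤ a * a := by gcongr
          _ ≤ _ := by rw [← sq]; exact le_self_add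
    have hL2 : ∀ g : Space → ℂ, MemLp g 2 (volume : Measure Space) → ∫⁻ z, ‖g z‖ₑ ^ 2 < ∞ := by
      intro g hg
      simpa using lintegral_rpow_enorm_lt_top_of_eLpNorm_lt_top (by norm_num) (by norm_num) hg.2
    rw [hasFiniteIntegral_def, lintegral_prod_symm _ (by
      simp only [Function.uncurry_def]
      fun_prop)]
    simp only [Function.uncurry, enorm_mul]
    calc _ ≤ ∫⁻ z, (‖v z‖ₑ ^ 2 + (∫⁻ e, ‖V e‖ₑ * ‖d (z - e)‖ₑ) ^ 2) := by
          refine lintegral_mono fun z => ?_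
          rw [lintegral_const_mul _ (by fun_prop)]
          exact hsq _ _
      _ < ∞ := by
          rw [lintegral_add_left (by fun_prop)]
          refine ENNReal.add_lt_top.mpr ⟨hL2 _ (v.memLp 2), lt_of_le_of_lt
            (lintegral_sq_lconvolution_le (A := fun e => ‖V e‖ₑ) (B := fun e => ‖d e‖ₑ)
              (by fun_prop) (by fun_prop)) (ENNReal.mul_lt_top ?_ (hL2 _ (Lp.memLp d)))⟩
          exact ENNReal.pow_lt_top hV.2
  calc _ = ∫ x, ∫ e, u x * c x * (chi x e * V e) := by
        refine integral_congr_ae (ae_of_all _ fun x => ?_)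
        simp only
        rw [integral_const_mul]
        ring
    _ = ∫ e, ∫ x, u x * c x * (chi x e * V e) := integral_integral_swap h1
    _ = ∫ e, ∫ z, v z * (V e * d (z - e)) := by
        refine integral_congr_ae (ae_of_all _ fun e => ?_)
        have h := integral_modulate_fourier_mul c v e
        rw [huv] at h
        calc _ = V e * ∫ x, chi e x * u x * c x := by
              rw [← integral_const_mul]
              refine integral_congr_ae (ae_of_all _ fun x => ?_)
              simp only [chi_comm e x]
              ring
          _ = V e * ∫ z, v z * d (z - e) := by
              rw [h, ← integral_add_right_eq_self (fun z => v z * d (z - e)) e]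
              simp [d]
          _ = _ := by
              rw [← integral_const_mul]
              exact integral_congr_ae (ae_of_all _ fun x => by ring)
    _ = ∫ z, ∫ e, v z * (V e * d (z - e)) := integral_integral_swap h2
    _ = _ := by simp only [integral_const_mul]

/-- The trilinear term `(1/|x| * (a conj b)) c` loses half a derivative. -/
theorem exists_memSobolev_newton_mul {s : ℝ} (hs : 1 / 2 ≤ s)
    {a b c : Lp ℂ 2 (volume : Measure Space)} (ha : MemSobolev s 2 (a : 𝓢'(Space, ℂ)))
    (hb : MemSobolev s 2 (b : 𝓢'(Space, ℂ))) (hc : MemSobolev s 2 (c : 𝓢'(Space, ℂ))) :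
    ∃ G : 𝓢'(Space, ℂ), MemSobolev (s - 1 / 2) 2 G ∧ ∀ u : 𝓢(Space, ℂ),
      Integrable (fun x => u x * (newton (fun y => a y * (starRingEnd ℂ) (b y)) x * c x)) ∧
      G u = ∫ x, u x * (newton (fun y => a y * (starRingEnd ℂ) (b y)) x * c x) := by
  have ht : 0 ≤ s - 1 / 2 := by linarith
  have ham := measurable_coe_lp a
  have hbm := measurable_coe_lp b
  set d : Lp ℂ 2 (volume : Measure Space) := 𝓕 c with hd_def
  have hdm := measurable_coe_lp d
  set f : Space → ℂ := fun x => a x * (starRingEnd ℂ) (b x)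
  have hf : Integrable f := integrable_mul_conj a b
  have hfm : Measurable f := ham.mul (Complex.continuous_conj.measurable.comp hbm)
  set V : Space → ℂ := fun e => (((Real.pi * ‖e‖ ^ 2)⁻¹ : ℝ) : ℂ) * 𝓕 f e
  have hFm : Continuous (𝓕 f) := VectorFourier.fourierIntegral_continuous
    Real.continuous_fourierChar continuous_inner hf
  have hVm : Measurable V := by fun_prop
  have hVw : ∫⁻ e, ENNReal.ofReal (weight (s - 1 / 2) e) * ‖V e‖ₑ < ∞ :=
    lintegral_weight_mul_fourier_mul_conj_lt_top hs ha hb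
  have hVi : Integrable V := by
    refine ⟨hVm.aestronglyMeasurable, lt_of_le_of_lt (lintegral_mono fun e => ?_) hVw⟩
    exact le_mul_of_one_le_left' (ENNReal.one_le_ofReal.mpr (one_le_weight ht e))
  have hdw : ∫⁻ x, (ENNReal.ofReal (weight (s - 1 / 2) x) * ‖d x‖ₑ) ^ 2 < ∞ :=
    lintegral_weight_mul_fourier_sq_lt_top ht (hc.mono (by linarith))
  set W : Space → ℂ := fun z => ∫ e, V e * d (z - e)
  have hWm : StronglyMeasurable W := by
    refine StronglyMeasurable.integral_prod_right ?_
    exact Measurable.stronglyMeasurable (by fun_prop)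
  have hWw : ∫⁻ x, (ENNReal.ofReal (weight (s - 1 / 2) x) * ‖W x‖ₑ) ^ 2 < ∞ := by
    refine lt_of_le_of_lt (lintegral_mono fun x => ?_)
      (lintegral_weight_mul_convolution_sq_lt_top ht hVm hdm hVw hdw)
    gcongr
    exact enorm_convolution_le V d x
  have hW2 : MemLp W 2 (volume : Measure Space) := by
    refine ⟨hWm.aestronglyMeasurable, ?_⟩
    rw [eLpNorm_lt_top_iff_lintegral_rpow_enorm_lt_top (by norm_num) (by norm_num)]
    refine lt_of_le_of_lt (lintegral_mono fun x => ?_) hWw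
    simp only [ENNReal.toReal_ofNat, ENNReal.rpow_two]
    gcongr
    exact le_mul_of_one_le_left' (ENNReal.one_le_ofReal.mpr (one_le_weight ht x))
  have hnewton : newton f =ᵐ[volume] fun x => ∫ e, chi x e * V e := newton_ae_eq hfm hf hVi
  -- The witness is built on the Fourier side as the inverse transform of V * 𝓕 c, where its Sobolev
  -- bound is known. Integrability against u holds because the potential is bounded by the L¹ norm
  -- of V.
  refine ⟨𝓕⁻ (hW2.toLp W : 𝓢'(Space, ℂ)), memSobolev_fourierInv ?_, fun u => ⟨?_, ?_⟩⟩
  · refine lt_of_le_of_lt (le_of_eq (lintegral_congr_ae ?_)) hWw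
    filter_upwards [hW2.coeFn_toLp] with x hx
    rw [hx]
  · have huc : Integrable fun x => u x * c x := (u.memLp 2).integrable_mul (Lp.memLp c)
    have hP : AEStronglyMeasurable (fun x => ∫ e, chi x e * V e) (volume : Measure Space) := by
      refine StronglyMeasurable.aestronglyMeasurable (StronglyMeasurable.integral_prod_right ?_)
      have := continuous_chi_uncurry.measurable
      exact Measurable.stronglyMeasurable (by fun_prop)
    have h := huc.bdd_mul (c := ∫ e, ‖V e‖) hP (ae_of_all _ fun x => by
      refine (norm_integral_le_integral_norm _).trans (le_of_eq ?_)
      simp)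
    refine h.congr ?_
    filter_upwards [hnewton] with x hx
    rw [hx]
    ring
  · rw [TemperedDistribution.fourierInv_apply, Lp.toTemperedDistribution_apply]
    calc _ = ∫ z, 𝓕⁻ u z * W z := by
          refine integral_congr_ae ?_
          filter_upwards [hW2.coeFn_toLp] with x hx
          rw [hx, smul_eq_mul]
      _ = ∫ x, u x * ((∫ e, chi x e * V e) * c x) :=
          (integral_mul_chi_integral_mul hVm hVi c u).symm
      _ = _ := by
          refine integral_congr_ae ?_
          filter_upwards [hnewton] with x hx
          rw [hx]

/-! ### Nonlinearity, elliptic regularity and bootstrap -/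

theorem memSobolev_sum {ι : Type*} (S : Finset ι) {s : ℝ} {G : ι → 𝓢'(Space, ℂ)}
    (h : ∀ i ∈ S, MemSobolev s 2 (G i)) : MemSobolev s 2 (∑ i ∈ S, G i) := by
  classical
  induction S using Finset.induction_on with
  | empty => simp
  | insert i S hi ih =>
    rw [Finset.sum_insert hi]
    exact (h i (Finset.mem_insert_self _ _)).add
      (ih fun k hk => h k (Finset.mem_insert_of_mem hk))

theorem exists_memSobolev_nonlinearity {K : ℕ} (lam : Fin K → ℝ)
    (φ : Fin K → Lp ℂ 2 (volume : Measure Space)) {s : ℝ} (hs : 1 / 2 ≤ s)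
    (hφ : ∀ j, MemSobolev s 2 (φ j : 𝓢'(Space, ℂ))) (j : Fin K) :
    ∃ G : 𝓢'(Space, ℂ), MemSobolev (s - 1 / 2) 2 G ∧ ∀ u : 𝓢(Space, ℂ),
      G u = ∫ x, u x * nonlinearity lam (fun k => (φ k : Space → ℂ)) j x := by
  -- G carries the direct terms, H the exchange terms; the integrability they come with allows
  -- termwise integration of the sums.
  choose G hG hGu using fun k => exists_memSobolev_newton_mul hs (hφ k) (hφ k) (hφ j)
  choose H hH hHu using fun k => exists_memSobolev_newton_mul hs (hφ j) (hφ k) (hφ k)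
  refine ⟨∑ k, (lam k : ℂ) • G k - ∑ k, (lam k : ℂ) • H k,
    (memSobolev_sum _ fun k _ => (hG k).smul _).sub (memSobolev_sum _ fun k _ => (hH k).smul _),
    fun u => ?_⟩
  have hsq : ∀ k, (fun y => ((‖φ k y‖ ^ 2 : ℝ) : ℂ)) =
      fun y => φ k y * (starRingEnd ℂ) (φ k y) := fun k => by
    funext y
    rw [Complex.mul_conj, Complex.normSq_eq_norm_sq]
  have hpt : ∀ x, u x * nonlinearity lam (fun k => (φ k : Space → ℂ)) j x =
      (∑ k, (lam k : ℂ) *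
        (u x * (newton (fun y => φ k y * (starRingEnd ℂ) (φ k y)) x * φ j x))) -
      ∑ k, (lam k : ℂ) *
        (u x * (newton (fun y => φ j y * (starRingEnd ℂ) (φ k y)) x * φ k x)) := by
    intro x
    simp only [nonlinearity, hsq]
    rw [mul_sub, Finset.mul_sum, Finset.mul_sum]
    congr 1 <;> exact Finset.sum_congr rfl fun k _ => by ring
  simp only [hpt]
  rw [integral_sub (integrable_finsetSum _ fun k _ => (hGu k u).1.const_mul _)
    (integrable_finsetSum _ fun k _ => (hHu k u).1.const_mul _),
    integral_finsetSum _ fun k _ => (hGu k u).1.const_mul _,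
    integral_finsetSum _ fun k _ => (hHu k u).1.const_mul _]
  simp only [integral_const_mul, ← (hGu _ u).2, ← (hHu _ u).2]
  simp

/-- The symbol of `(1 - Δ) ^ (-1/2)`. -/
noncomputable def invRelSymbol (ξ : Space) : ℂ :=
  (((1 + (2 * Real.pi * ‖ξ‖) ^ 2) ^ (-1 / 2 : ℝ) : ℝ) : ℂ)

theorem invRelSymbol_hasTemperateGrowth : invRelSymbol.HasTemperateGrowth := by
  have h1 := Function.hasTemperateGrowth_one_add_norm_sq_rpow Space (-1 / 2)
  have h2 : (fun ξ : Space => (2 * Real.pi) • ξ).HasTemperateGrowth :=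
    ((2 * Real.pi) • ContinuousLinearMap.id ℝ Space).hasTemperateGrowth
  have h3 := Function.HasTemperateGrowth.comp Function.Complex.hasTemperateGrowth_ofReal
    (h1.comp h2)
  have h : invRelSymbol = fun ξ : Space =>
      ((((1 + ‖(2 * Real.pi) • ξ‖ ^ 2) ^ (-1 / 2 : ℝ) : ℝ)) : ℂ) := by
    funext ξ
    rw [invRelSymbol, norm_smul, Real.norm_of_nonneg (by positivity)]
  rw [h]
  exact h3

theorem relSymbol_mul_invRelSymbol : relSymbol * invRelSymbol = fun _ => 1 := by
  funext ξ
  rw [Pi.mul_apply, relSymbol, invRelSymbol, Real.sqrt_eq_rpow, ← Complex.ofReal_mul,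
    ← Real.rpow_add (by positivity)]
  norm_num

/-- Elliptic regularity for `√(1 - Δ)`. -/
theorem memSobolev_add_one_of_sqrtOneSubLaplacian {r : ℝ} {f : 𝓢'(Space, ℂ)}
    (h : MemSobolev r 2 (sqrtOneSubLaplacian f)) : MemSobolev (1 + r) 2 f := by
  rw [← memSobolev_besselPotential_iff]
  have hf : f = fourierMultiplierCLM ℂ invRelSymbol (sqrtOneSubLaplacian f) := by
    rw [sqrtOneSubLaplacian, fourierMultiplierCLM_fourierMultiplierCLM_apply
      relSymbol_hasTemperateGrowth invRelSymbol_hasTemperateGrowth, relSymbol_mul_invRelSymbol]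
    simp
  rw [hf]
  change MemSobolev r 2 (fourierMultiplierCLM ℂ (fun x => (weight 1 x : ℂ)) _)
  rw [fourierMultiplierCLM_fourierMultiplierCLM_apply invRelSymbol_hasTemperateGrowth
    (weight_hasTemperateGrowth 1)]
  refine h.fourierMultiplierCLM_of_bounded
    (invRelSymbol_hasTemperateGrowth.mul (weight_hasTemperateGrowth 1)) ⟨1, fun x => ?_⟩
  rw [Pi.mul_apply, invRelSymbol, weight, ← Complex.ofReal_mul, Complex.norm_real,
    Real.norm_of_nonneg (by positivity)]
  -- The Bessel weight uses |x| and the operator's symbol 2π|x|; as 2π ≥ 1 their quotient is at most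
  -- 1.
  have hpi : 1 ≤ 2 * Real.pi := by linarith [Real.pi_gt_three]
  have hx : ‖x‖ ≤ 2 * Real.pi * ‖x‖ := le_mul_of_one_le_left (norm_nonneg x) hpi
  calc _ ≤ (1 + (2 * Real.pi * ‖x‖) ^ 2) ^ (-1 / 2 : ℝ) *
        (1 + (2 * Real.pi * ‖x‖) ^ 2) ^ (1 / 2 : ℝ) := by gcongr
    _ = 1 := by
        rw [← Real.rpow_add (by positivity)]
        norm_num

/-- The nonlinearity costs 1/2 and inverting √(1-Δ) gains 1. Regularity of every component is
assumed because each equation couples all of them. -/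
theorem IsSolution.memSobolev_add_half {K : ℕ} {lam ν : Fin K → ℝ}
    {φ : Fin K → Lp ℂ 2 (volume : Measure Space)} (hsol : IsSolution lam ν φ) {s : ℝ}
    (hs : 1 / 2 ≤ s) (hφ : ∀ j, MemSobolev s 2 (φ j : 𝓢'(Space, ℂ))) (j : Fin K) :
    MemSobolev (s + 1 / 2) 2 (φ j : 𝓢'(Space, ℂ)) := by
  obtain ⟨G, hG, hGu⟩ := exists_memSobolev_nonlinearity lam φ hs hφ j
  have heq : sqrtOneSubLaplacian (φ j : 𝓢'(Space, ℂ)) - (φ j : 𝓢'(Space, ℂ)) +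
      (ν j : ℂ) • (φ j : 𝓢'(Space, ℂ)) = G := by
    ext u
    rw [hsol j u, hGu u]
  have hr : MemSobolev (s - 1 / 2) 2 (φ j : 𝓢'(Space, ℂ)) := (hφ j).mono (by linarith)
  have h : MemSobolev (s - 1 / 2) 2 (sqrtOneSubLaplacian (φ j : 𝓢'(Space, ℂ))) := by
    have := (hG.add hr).sub (hr.smul (ν j : ℂ))
    rw [← heq] at this
    convert this using 1
    abel
  have := memSobolev_add_one_of_sqrtOneSubLaplacian h
  convert this using 1
  ring

end RelHartreeFock

theorem mainTheorem11 (K : ℕ) (hK : 0 < K) (lam ν : Fin K → ℝ)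
    (hlam : ∀ j, 0 < lam j) (hν : ∀ j, 0 < ν j)
    (φ : Fin K → Lp ℂ 2 (volume : Measure RelHartreeFock.Space))
    (hφ : ∀ j, MemSobolev (1 / 2) 2 (φ j : 𝓢'(RelHartreeFock.Space, ℂ)))
    (hsol : RelHartreeFock.IsSolution lam ν φ) :
    ∀ (j : Fin K) (s : ℝ), 1 / 2 ≤ s →
      MemSobolev s 2 (φ j : 𝓢'(RelHartreeFock.Space, ℂ)) := by
  have hn : ∀ (n : ℕ) (j : Fin K),
      MemSobolev (1 / 2 + n * (1 / 2)) 2 (φ j : 𝓢'(RelHartreeFock.Space, ℂ)) := by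
    intro n
    induction n with
    | zero => simpa using hφ
    | succ n ih =>
      intro j
      have h := hsol.memSobolev_add_half (s := 1 / 2 + n * (1 / 2))
        (le_add_of_nonneg_right (by positivity)) ih j
      convert h using 1
      push_cast
      ring
  intro j s _
  -- After n ≥ 2s steps the exponent 1/2 + n/2 exceeds s.
  obtain ⟨n, hns⟩ := exists_nat_ge (2 * s)
  exact (hn n j).mono (by linarith)
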